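/- Let $a_1,\dots,a_k\in\mathbb{R}^m$ generate a lattice (discrete subgroup) $L=\sum_{j}\mathbb{Z}a_j$ of rank $r\le k$. Let $q_0\ge q\ge 1$ be integers and let $\hat a_1,\dots,\hat a_k\in\mathbb{Z}^m$ be approximations of the $a_j$ of precision $q$ with denominator $2^{q_0}$, i.e. $\left|\hat a_j^{(i)}/2^{q_0}-a_j^{(i)}\right|\le 2^{-q}$ for all $j\le k$ and all coordinates $i\le m$. Let $\tilde b_j=(m_j,\hat b_j)\in\mathbb{Z}^k\times\mathbb{Z}^m$, $1\le j\le k$, be an LLL-reduced basis (with the classical constant $3/4$), as output by the LLL algorithm, of the rank $k$ lattice generated by the vectors $\tilde a_j=(e_j,\hat a_j)$, where $e_j$ is the $j$-th unit vector of $\mathbb{Z}^k$. Let $0<\mu\le\lambda_1(L)=\min\{\|v\| : v\in L\setminus\{0\}\}$ (no upper bound on $\mu$ if $L=0$), let $\alpha\ge\max_j\|a_j\|$, and let $\det(L)$ be the square root of the Gram determinant of a $\mathbb{Z}$-basis of $L$ (so $\det(0)=1$). Put $$\lambda:=\left(k\sqrt m\,2^{q_0-q}+\sqrt k\right)\frac{\alpha^r}{\det(L)}$$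 and assume $$2^q>\frac{(\sqrt{mk}+1)\,\lambda\,2^{\frac{k-1}{2}}}{\mu}.$$ Choose any $r$ linearly independent vectors among the $a_j$, let $L_r$ be the lattice they generate, and for $1\le j\le r$ let $\lambda_j(L_r)$ be its $j$-th successive minimum, the least $\rho$ such that $L_r$ contains $j$ linearly independent vectors of norm at most $\rho$. Then: 1. the vectors $m_1,\dots,m_{k-r}$ are linearly independent relations for the $a_j$, i.e. $\sum_{l\le k}m_j^{(l)}a_l=0$ for $j\le k-r$; 2. the vectors $b_j=\sum_{l\le k}m_{k-r+j}^{(l)}a_l$, $1\le j\le r$, form a basis of $L$, and $$\|b_j\|\le(\sqrt{km}+1)\,2^{\frac{k-1}{2}+1+q_0-q}\,\lambda_j(L_r);$$ 3. in the Euclidean norm, $$\|m_j\|\le 2^{\frac{k-1}{2}}\lambda\quad(1\le j\le k-r),\qquad \|m_j\|\le 2^{\frac{k-1}{2}+q_0+1}\lambda_{j-k+r}(L_r)\quad(k-r+1\le j\le k).$$ -/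

import Mathlib

noncomputable section

namespace ApproxLattice

/-- The integer vector `z`, seen as a point of Euclidean space. -/
def intVec {ι : Type*} (z : ι → ℤ) : EuclideanSpace ℝ ι :=
  WithLp.toLp 2 (fun i => (z i : ℝ))

/-- The integer vector `ahat` is an approximation of `a` with precision `q` and
denominator `2 ^ q₀`. -/
def IsApprox {m : ℕ} (q₀ q : ℕ) (ahat : Fin m → ℤ) (a : EuclideanSpace ℝ (Fin m)) : Prop :=
  ∀ i, |(ahat i : ℝ) / 2 ^ q₀ - a i| ≤ 1 / 2 ^ q

/-- The subgroup `∑ j, ℤ a_j` generated by a finite family of vectors. -/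
def latticeOf {ι E : Type*} [AddCommGroup E] (a : ι → E) : Submodule ℤ E :=
  Submodule.span ℤ (Set.range a)

/-- The augmented vectors `(e_j, ahat_j)` in `ℤ^k × ℤ^m`. -/
def augmented {k m : ℕ} (ahat : Fin k → Fin m → ℤ) (j : Fin k) : Fin k ⊕ Fin m → ℤ :=
  Sum.elim (Pi.single j 1) (ahat j)

section Lattice

variable {E : Type*} [NormedAddCommGroup E] [InnerProductSpace ℝ E]

open Classical in
/-- The determinant of a lattice `L`, not necessarily of full rank: the square root of the Gram
determinant of a `ℤ`-basis of `L` (which does not depend on the basis). For `L = 0` it is `1`. -/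
def latticeDet (L : Submodule ℤ E) : ℝ :=
  if h : Nonempty (Module.Basis (Fin (Module.finrank ℤ L)) ℤ L) then
    √(Matrix.gram ℝ fun i => (h.some i : E)).det
  else 0

/-- The `j`-th successive minimum of `L` (for `1 ≤ j ≤ rank L`): the least radius such that the
closed ball of that radius contains `j` linearly independent vectors of `L`. -/
def successiveMin (L : Submodule ℤ E) (j : ℕ) : ℝ :=
  sInf {ρ : ℝ | 0 ≤ ρ ∧ ∃ v : Fin j → E, LinearIndependent ℝ v ∧ ∀ i, v i ∈ L ∧ ‖v i‖ ≤ ρ}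

/-- The Gram–Schmidt coefficient `μ_{i,j} = ⟨v_i, v_j*⟩ / ⟨v_j*, v_j*⟩`. -/
def gsCoeff {k : ℕ} (v : Fin k → E) (i j : Fin k) : ℝ :=
  inner ℝ (v i) (InnerProductSpace.gramSchmidt ℝ v j) /
    ‖InnerProductSpace.gramSchmidt ℝ v j‖ ^ 2

/-- A linearly independent family is LLL-reduced (with the classical constant `3/4`) if it is
size-reduced and consecutive vectors satisfy the Lovász condition. -/
structure IsLLLReduced {k : ℕ} (v : Fin k → E) : Prop where
  linearIndependent : LinearIndependent ℝ v
  size_reduced : ∀ i j : Fin k, j < i → |gsCoeff v i j| ≤ 1 / 2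
  lovasz : ∀ i j : Fin k, (j : ℕ) + 1 = i →
    3 / 4 * ‖InnerProductSpace.gramSchmidt ℝ v j‖ ^ 2 ≤
      ‖InnerProductSpace.gramSchmidt ℝ v i +
        gsCoeff v i j • InnerProductSpace.gramSchmidt ℝ v j‖ ^ 2

/-- `b` is an LLL-reduced basis of the lattice `L`. -/
def IsLLLReducedBasis {k : ℕ} (L : Submodule ℤ E) (b : Fin k → E) : Prop :=
  IsLLLReduced b ∧ latticeOf b = L

end Lattice

/-- The first `k - r` indices among `k`. -/
def firstIdx {k r : ℕ} (j : Fin (k - r)) : Fin k := ⟨j, by omega⟩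

/-- The last `r` indices among `k`: `j ↦ k - r + j`. -/
def lastIdx {k r : ℕ} (hrk : r ≤ k) (j : Fin r) : Fin k := ⟨k - r + j, by omega⟩

/-- The coefficient part `m_j ∈ ℤ^k` of the vector `(m_j, bhat_j)`. -/
def coeffPart {k m : ℕ} (b : Fin k → Fin k ⊕ Fin m → ℤ) (j : Fin k) : Fin k → ℤ :=
  fun l => b j (Sum.inl l)

/-- The integral combination `∑ l, c_l a_l`. -/
def intComb {k : ℕ} {E : Type*} [AddCommGroup E] (c : Fin k → ℤ) (a : Fin k → E) : E :=
  ∑ l, c l • a l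

end ApproxLattice

end

open ApproxLattice

/-! An LLL-reduced basis is controlled vector by vector: if the lattice contains more than `j`
independent vectors of norm at most `M`, the basis vector of (zero-based) index `j` has norm at most
`2 ^ ((k-1)/2) * M` (`IsLLLReduced.norm_le_of_linearIndependent`). It therefore suffices to exhibit
short vectors in the augmented lattice.

Cramer's rule with Hadamard's inequality (`exists_cramer`) expresses a nonzero multiple of each
unchosen `a_l` through the chosen `a (s i)`. This gives `k - r` independent relations whose
augmented vectors have norm at most `lam`. Hence the first `k - r` reduced vectors are short, and
`two_pow_mul_norm_intComb_le` with the precision hypothesis makes their combinations shorter than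
`μ`, so zero. The other `r` combinations must then generate `L`.

For their size, independent vectors of `L_r` of norm at most `ρ` lift to augmented vectors of norm
at most `2 ^ (q₀+1) * ρ` (`exists_short_lift`). Together with the relations they stay independent,
and the LLL bound applies again. -/

namespace ApproxLattice

open InnerProductSpace Module

/-! ### Gram determinants and the lattice determinant. -/

section Determinant

variable {E : Type*} [NormedAddCommGroup E] [InnerProductSpace ℝ E]

/-- Hadamard's inequality for Gram determinants. -/
theorem sqrt_det_gram_le_prod_norm {n : ℕ} (v : Fin n → E) :
    √(Matrix.gram ℝ v).det ≤ ∏ i, ‖v i‖ := by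
  by_cases h0 : (Matrix.gram ℝ v).det = 0
  · rw [h0, Real.sqrt_zero]
    exact Finset.prod_nonneg fun i _ => norm_nonneg _
  have hv : LinearIndependent ℝ v := Matrix.linearIndependent_of_det_gram_ne_zero h0
  let S := Submodule.span ℝ (Set.range v)
  have hS : finrank ℝ S = n := by simpa using finrank_span_eq_card hv
  have : FiniteDimensional ℝ S := FiniteDimensional.span_of_finite ℝ (Set.finite_range v)
  have : Fact (finrank ℝ S = n) := ⟨hS⟩
  let b : OrthonormalBasis (Fin n) ℝ S := (stdOrthonormalBasis ℝ S).reindex (finCongr hS)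
  let w : Fin n → S := fun i => ⟨v i, Submodule.subset_span ⟨i, rfl⟩⟩
  have hgram : Matrix.gram ℝ v = Matrix.gram ℝ w := rfl
  -- In an orthonormal basis of the span, the Gram determinant is a squared volume, and a volume is
  -- at most the product of the norms.
  have hdet : (Matrix.gram ℝ v).det = b.toBasis.det w ^ 2 := by
    rw [hgram, Matrix.gram_eq_conjTranspose_mul b, Matrix.det_mul, Matrix.det_conjTranspose,
      Basis.det_apply, star_trivial, sq]
    rfl
  rw [hdet, Real.sqrt_sq_eq_abs, ← Orientation.volumeForm_robust' b.toBasis.orientation b w]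
  exact Orientation.abs_volumeForm_apply_le _ w

theorem gram_sum_smul {n : ℕ} (B : Fin n → E) (P : Matrix (Fin n) (Fin n) ℝ) :
    Matrix.gram ℝ (fun i => ∑ j, P i j • B j) = P * Matrix.gram ℝ B * P.transpose := by
  ext i j
  simp only [Matrix.gram_apply, sum_inner, inner_sum, inner_smul_left, inner_smul_right,
    Matrix.mul_apply, Matrix.transpose_apply, Finset.mul_sum, Finset.sum_mul]
  refine Finset.sum_congr rfl fun x _ => Finset.sum_congr rfl fun y _ => ?_
  simp only [conj_trivial]
  ring

theorem abs_det_mul_sqrt_det_gram_le {n : ℕ} (B w : Fin n → E) (P : Matrix (Fin n) (Fin n) ℤ)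
    (hw : ∀ i, w i = ∑ j, P i j • B j) :
    |(P.det : ℝ)| * √(Matrix.gram ℝ B).det ≤ ∏ i, ‖w i‖ := by
  have hw' : w = fun i => ∑ j, (P.map (Int.cast : ℤ → ℝ)) i j • B j := by
    funext i
    rw [hw i]
    simp [Int.cast_smul_eq_zsmul]
  have hP : (P.map (Int.cast : ℤ → ℝ)).det = (P.det : ℝ) := (Int.cast_det P).symm
  have h := sqrt_det_gram_le_prod_norm w
  have e : (Matrix.gram ℝ w).det = (P.det : ℝ) ^ 2 * (Matrix.gram ℝ B).det := by
    rw [hw', gram_sum_smul, Matrix.det_mul, Matrix.det_mul, Matrix.det_transpose, hP]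
    ring
  rwa [e, Real.sqrt_mul (sq_nonneg _), Real.sqrt_sq_eq_abs] at h

/-- The real span of a `ℤ`-basis contains the `r` independent vectors `a (s i)`, so its `r` elements
are independent over `ℝ` too and their Gram matrix is positive definite. -/
theorem exists_basis_latticeDet {k r : ℕ} (a : Fin k → E)
    (hrank : finrank ℤ (latticeOf a) = r) (s : Fin r → Fin k)
    (hs : LinearIndependent ℝ (fun i => a (s i))) :
    ∃ B : Fin r → E, LinearIndependent ℝ B ∧ latticeOf B = latticeOf a ∧
      latticeDet (latticeOf a) = √(Matrix.gram ℝ B).det ∧ 0 < latticeDet (latticeOf a) := by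
  subst hrank
  have : Module.Finite ℤ (latticeOf a) :=
    Module.Finite.span_of_finite ℤ (Set.finite_range a)
  -- Torsion-freeness makes the finitely generated lattice free, as `finBasis` needs.
  let _ : Module ℚ E := Module.compHom E (algebraMap ℚ ℝ)
  have : IsAddTorsionFree E := IsAddTorsionFree.of_module_rat E
  have hne : Nonempty (Basis (Fin (finrank ℤ (latticeOf a))) ℤ (latticeOf a)) :=
    ⟨Module.finBasis ℤ (latticeOf a)⟩
  have hspan : latticeOf (fun i => (hne.some i : E)) = latticeOf a := by
    have h := congrArg (Submodule.map (latticeOf a).subtype) hne.some.span_eq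
    rw [Submodule.map_span, Submodule.map_top, Submodule.range_subtype, ← Set.range_comp] at h
    exact h
  have hind : LinearIndependent ℝ (fun i => (hne.some i : E)) := by
    rw [linearIndependent_iff_card_le_finrank_span, Set.finrank]
    have hle : Submodule.span ℝ (Set.range fun i => a (s i)) ≤
        Submodule.span ℝ (Set.range fun i => (hne.some i : E)) := by
      rw [Submodule.span_le]
      rintro _ ⟨i, rfl⟩
      have : a (s i) ∈ latticeOf (fun i => (hne.some i : E)) := by
        rw [hspan]
        exact Submodule.subset_span ⟨s i, rfl⟩
      exact Submodule.span_le_restrictScalars ℤ ℝ _ this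
    have := FiniteDimensional.span_of_finite ℝ (Set.finite_range fun i => (hne.some i : E))
    have h := Submodule.finrank_mono hle
    rwa [finrank_span_eq_card hs] at h
  have hdet : latticeDet (latticeOf a) = √(Matrix.gram ℝ fun i => (hne.some i : E)).det := by
    rw [latticeDet, dif_pos hne]
  refine ⟨fun i => (hne.some i : E), hind, hspan, hdet, ?_⟩
  rw [hdet]
  exact Real.sqrt_pos.2 (Matrix.posDef_gram_of_linearIndependent hind).det_pos

end Determinant

/-! ### Length bounds for LLL-reduced bases. -/

section Reduced

variable {E : Type*} [NormedAddCommGroup E] [InnerProductSpace ℝ E]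

theorem norm_sum_sq_of_pairwise_inner_eq_zero {ι : Type*} (s : Finset ι) (g : ι → E)
    (hg : Pairwise fun i j => inner ℝ (g i) (g j) = 0) :
    ‖∑ i ∈ s, g i‖ ^ 2 = ∑ i ∈ s, ‖g i‖ ^ 2 := by
  classical
  induction s using Finset.induction_on with
  | empty => simp
  | insert i s hi ih =>
    have h : inner ℝ (g i) (∑ j ∈ s, g j) = 0 := by
      rw [inner_sum]
      exact Finset.sum_eq_zero fun j hj => hg (by rintro rfl; exact hi hj)
    rw [Finset.sum_insert hi, Finset.sum_insert hi, norm_add_sq_real, h, ih]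
    ring

variable {k : ℕ} {v : Fin k → E}

theorem eq_gramSchmidt_add_sum_gsCoeff (v : Fin k → E) (i : Fin k) :
    v i = gramSchmidt ℝ v i + ∑ l ∈ Finset.Iio i, gsCoeff v i l • gramSchmidt ℝ v l := by
  have h := gramSchmidt_def'' ℝ v i
  simp only [RCLike.ofReal_real_eq_id, id_eq] at h
  simpa only [gsCoeff, real_inner_comm] using h

theorem inner_gramSchmidt_self (v : Fin k → E) (i : Fin k) :
    inner ℝ (v i) (gramSchmidt ℝ v i) = ‖gramSchmidt ℝ v i‖ ^ 2 := by
  conv_lhs => rw [eq_gramSchmidt_add_sum_gsCoeff v i]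
  rw [inner_add_left, sum_inner, Finset.sum_eq_zero, add_zero, real_inner_self_eq_norm_sq]
  intro l hl
  rw [inner_smul_left, gramSchmidt_orthogonal ℝ v (Finset.mem_Iio.1 hl).ne, mul_zero]

theorem norm_sq_eq_gramSchmidt_add_sum (v : Fin k → E) (i : Fin k) :
    ‖v i‖ ^ 2 = ‖gramSchmidt ℝ v i‖ ^ 2 +
      ∑ l ∈ Finset.Iio i, gsCoeff v i l ^ 2 * ‖gramSchmidt ℝ v l‖ ^ 2 := by
  have h0 : inner ℝ (gramSchmidt ℝ v i)
      (∑ l ∈ Finset.Iio i, gsCoeff v i l • gramSchmidt ℝ v l) = 0 := by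
    rw [inner_sum]
    refine Finset.sum_eq_zero fun l hl => ?_
    rw [inner_smul_right, gramSchmidt_orthogonal ℝ v (Finset.mem_Iio.1 hl).ne', mul_zero]
  conv_lhs => rw [eq_gramSchmidt_add_sum_gsCoeff v i]
  rw [norm_add_sq_real, h0, norm_sum_sq_of_pairwise_inner_eq_zero]
  · simp [norm_smul, mul_pow]
  · intro x y hxy
    simp only [inner_smul_left, inner_smul_right, gramSchmidt_orthogonal ℝ v hxy, mul_zero]

/-- By orthogonality the Lovász condition and `|μ_{i,j}| ≤ 1/2` leave the factor `3/4 - 1/4 = 1/2`.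
-/
theorem IsLLLReduced.norm_gramSchmidt_sq_le_succ (h : IsLLLReduced v) {i j : Fin k}
    (hij : (j : ℕ) + 1 = i) :
    ‖gramSchmidt ℝ v j‖ ^ 2 ≤ 2 * ‖gramSchmidt ℝ v i‖ ^ 2 := by
  have hlt : j < i := Fin.lt_def.2 (by omega)
  have h1 := h.lovasz i j hij
  have h2 : gsCoeff v i j ^ 2 ≤ (1 / 2) ^ 2 :=
    sq_le_sq.2 ((h.size_reduced i j hlt).trans (le_abs_self _))
  rw [norm_add_sq_real, inner_smul_right, gramSchmidt_orthogonal ℝ v hlt.ne', norm_smul, mul_pow,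
    Real.norm_eq_abs, sq_abs] at h1
  nlinarith [sq_nonneg ‖gramSchmidt ℝ v j‖]

theorem IsLLLReduced.norm_gramSchmidt_sq_le (h : IsLLLReduced v) (i j : Fin k) (hji : j ≤ i) :
    2 ^ (j : ℕ) * ‖gramSchmidt ℝ v j‖ ^ 2 ≤ 2 ^ (i : ℕ) * ‖gramSchmidt ℝ v i‖ ^ 2 := by
  obtain ⟨i, hi⟩ := i
  induction i with
  | zero =>
    obtain rfl : j = ⟨0, hi⟩ := le_antisymm hji (Fin.le_def.2 (Nat.zero_le _))
    rfl
  | succ n ih =>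
    rcases hji.eq_or_lt with rfl | hlt
    · rfl
    · have h1 := ih (by omega) (Fin.le_def.2 (Nat.lt_succ_iff.1 (Fin.lt_def.1 hlt)))
      have h2 := h.norm_gramSchmidt_sq_le_succ (i := ⟨n + 1, hi⟩) (j := ⟨n, by omega⟩) rfl
      refine h1.trans ?_
      calc (2 : ℝ) ^ n * ‖gramSchmidt ℝ v ⟨n, by omega⟩‖ ^ 2
          ≤ 2 ^ n * (2 * ‖gramSchmidt ℝ v ⟨n + 1, hi⟩‖ ^ 2) := by gcongr
        _ = _ := by ring

/-- Size reduction and a geometric series give `‖v j‖ ^ 2 ≤ G * (1/2 + (1/2) ^ (j+1)) ≤ G`, where `G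
= 2 ^ j * ‖v_j*‖ ^ 2`; this quantity is nondecreasing in `j`. -/
theorem IsLLLReduced.norm_sq_le (h : IsLLLReduced v) (i j : Fin k) (hji : j ≤ i) :
    ‖v j‖ ^ 2 ≤ 2 ^ (i : ℕ) * ‖gramSchmidt ℝ v i‖ ^ 2 := by
  refine le_trans ?_ (h.norm_gramSchmidt_sq_le i j hji)
  set G := 2 ^ (j : ℕ) * ‖gramSchmidt ℝ v j‖ ^ 2 with hG
  have hterm : ∀ l ∈ Finset.Iio j, gsCoeff v j l ^ 2 * ‖gramSchmidt ℝ v l‖ ^ 2 ≤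
      1 / 4 * G * (1 / 2) ^ (l : ℕ) := by
    intro l hl
    have hlj := Finset.mem_Iio.1 hl
    have h1 : gsCoeff v j l ^ 2 ≤ (1 / 2) ^ 2 :=
    sq_le_sq.2 ((h.size_reduced j l hlj).trans (le_abs_self _))
    have h2 : ‖gramSchmidt ℝ v l‖ ^ 2 ≤ G * (1 / 2) ^ (l : ℕ) := by
      rw [one_div, inv_pow, ← div_eq_mul_inv, le_div_iff₀ (by positivity), mul_comm]
      exact h.norm_gramSchmidt_sq_le j l hlj.le
    calc _ ≤ (1 / 2) ^ 2 * (G * (1 / 2) ^ (l : ℕ)) := by gcongr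
      _ = _ := by ring
  have hsum : ∑ l ∈ Finset.Iio j, (1 / 2 : ℝ) ^ (l : ℕ) = 2 - 2 * (1 / 2) ^ (j : ℕ) := by
    have e : ∑ l ∈ Finset.Iio j, (1 / 2 : ℝ) ^ (l : ℕ) =
        ∑ l ∈ Finset.range j, (1 / 2 : ℝ) ^ l := by
      rw [← Nat.Iio_eq_range, ← Fin.map_valEmbedding_Iio, Finset.sum_map]
      rfl
    rw [e, geom_sum_eq (by norm_num)]
    ring
  have hG' : ‖gramSchmidt ℝ v j‖ ^ 2 = G * (1 / 2) ^ (j : ℕ) := by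
    rw [hG, mul_right_comm, ← mul_pow]
    norm_num
  have hp : (1 / 2 : ℝ) ^ (j : ℕ) ≤ 1 := pow_le_one₀ (by norm_num) (by norm_num)
  have hG0 : 0 ≤ G := by positivity
  rw [norm_sq_eq_gramSchmidt_add_sum, hG']
  refine (add_le_add_right (Finset.sum_le_sum hterm) _).trans ?_
  rw [← Finset.mul_sum, hsum]
  nlinarith [mul_nonneg hG0 (sub_nonneg.2 hp)]

/-- Let `i` be the largest index with a nonzero coefficient; it is at least `j`. Pairing `x` with
`v_i*` isolates `c i * ‖v_i*‖ ^ 2`, and Cauchy–Schwarz concludes since the integer `c i` has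
absolute value at least 1. -/
theorem exists_norm_gramSchmidt_le {x : E} {j : Fin k} (hx : x ∈ latticeOf v)
    (hxj : x ∉ Submodule.span ℝ (v '' Set.Iio j)) :
    ∃ i, j ≤ i ∧ ‖gramSchmidt ℝ v i‖ ≤ ‖x‖ := by
  classical
  obtain ⟨c, rfl⟩ := (Submodule.mem_span_range_iff_exists_fun ℤ).1 hx
  let T := Finset.univ.filter fun l => j ≤ l ∧ c l ≠ 0
  have hT : T.Nonempty := by
    by_contra hT
    rw [Finset.not_nonempty_iff_eq_empty] at hT
    refine hxj (Submodule.sum_mem _ fun l _ => ?_)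
    by_cases hl : j ≤ l
    · have : c l = 0 := by
        by_contra hc
        have : l ∈ T := by simp [T, hl, hc]
        simp [hT] at this
      simp [this]
    · rw [← Int.cast_smul_eq_zsmul ℝ]
      exact Submodule.smul_mem _ _ (Submodule.subset_span ⟨l, not_le.1 hl, rfl⟩)
  obtain ⟨i, hi, hmax⟩ := T.exists_max_image id hT
  obtain ⟨hji, hci⟩ : j ≤ i ∧ c i ≠ 0 := by simpa [T] using hi
  refine ⟨i, hji, ?_⟩
  have hinner : inner ℝ (∑ l, c l • v l) (gramSchmidt ℝ v i) =
      (c i : ℝ) * ‖gramSchmidt ℝ v i‖ ^ 2 := by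
    rw [sum_inner, Finset.sum_eq_single i]
    · rw [← Int.cast_smul_eq_zsmul ℝ, real_inner_smul_left, inner_gramSchmidt_self]
    · intro l _ hl
      rcases hl.lt_or_gt with hl | hl
      · rw [← Int.cast_smul_eq_zsmul ℝ, real_inner_smul_left, real_inner_comm,
          gramSchmidt_inv_triangular ℝ v hl, mul_zero]
      · have : c l = 0 := by
          by_contra hc
          have := hmax l (by simp [T, hji.trans hl.le, hc])
          exact absurd hl (not_lt.2 this)
        simp [this]
    · simp
  have hCS := abs_real_inner_le_norm (∑ l, c l • v l) (gramSchmidt ℝ v i)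
  rw [hinner, abs_mul, abs_of_nonneg (sq_nonneg ‖gramSchmidt ℝ v i‖)] at hCS
  have hc1 : (1 : ℝ) ≤ |(c i : ℝ)| := by exact_mod_cast Int.one_le_abs hci
  rcases (norm_nonneg (gramSchmidt ℝ v i)).eq_or_lt with h0 | h0
  · rw [← h0]
    exact norm_nonneg _
  · refine le_of_mul_le_mul_right (le_trans ?_ hCS) h0
    rw [← sq]
    exact le_mul_of_one_le_left (sq_nonneg _) hc1

/-- The vectors of a reduced basis are bounded by any sufficiently large family of linearly
independent lattice vectors. -/
theorem IsLLLReduced.norm_le_of_linearIndependent (h : IsLLLReduced v) {ι : Type*} [Fintype ι]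
    {x : ι → E} (hx : LinearIndependent ℝ x) (hmem : ∀ t, x t ∈ latticeOf v) {M : ℝ}
    (hM : ∀ t, ‖x t‖ ≤ M) {j : Fin k} (hj : (j : ℕ) < Fintype.card ι) :
    ‖v j‖ ≤ (2 : ℝ) ^ (((k : ℝ) - 1) / 2) * M := by
  classical
  -- The vectors before `v j` span dimension at most `j`, too small for all the `x t`.
  obtain ⟨t, ht⟩ : ∃ t, x t ∉ Submodule.span ℝ (v '' Set.Iio j) := by
    by_contra! hall
    have hle : Submodule.span ℝ (Set.range x) ≤ Submodule.span ℝ (v '' Set.Iio j) := by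
      rw [Submodule.span_le]
      rintro _ ⟨t, rfl⟩
      exact hall t
    have hset : v '' Set.Iio j = ((Finset.Iio j).image v : Finset E) := by simp
    rw [hset] at hle
    have h1 := Submodule.finrank_mono hle
    rw [finrank_span_eq_card hx] at h1
    have h2 := finrank_span_finset_le_card (R := ℝ) ((Finset.Iio j).image v)
    have h3 : ((Finset.Iio j).image v).card ≤ j := Finset.card_image_le.trans (by simp)
    simp only [Set.finrank] at h2
    omega
  obtain ⟨i, hji, hi⟩ := exists_norm_gramSchmidt_le (hmem t) ht
  have hM0 : 0 ≤ M := (norm_nonneg _).trans (hM t)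
  have hpow : ((2 : ℝ) ^ (((k : ℝ) - 1) / 2)) ^ 2 = (2 : ℝ) ^ ((k : ℝ) - 1) := by
    rw [← Real.rpow_natCast, ← Real.rpow_mul (by norm_num)]
    congr 1
    push_cast
    ring
  have hik : (2 : ℝ) ^ (i : ℕ) ≤ (2 : ℝ) ^ ((k : ℝ) - 1) := by
    rw [← Real.rpow_natCast]
    refine Real.rpow_le_rpow_of_exponent_le (by norm_num) ?_
    have : ((i : ℕ) : ℝ) + 1 ≤ k := by exact_mod_cast i.isLt
    linarith
  refine le_of_sq_le_sq ?_ (by positivity)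
  rw [mul_pow, hpow]
  refine (h.norm_sq_le i j hji).trans ?_
  gcongr
  exact hi.trans (hM t)

end Reduced

/-! ### Cramer's rule with bounded integer coefficients. -/

section Cramer

theorem prod_norm_update_le {E : Type*} [SeminormedAddGroup E] {r : ℕ} (w : Fin r → E) {α : ℝ}
    (hw : ∀ i, ‖w i‖ ≤ α) (i : Fin r) (x : E) : ∏ t, ‖Function.update w i x t‖ ≤ ‖x‖ * α ^ (r - 1) := by
  rw [← Finset.mul_prod_erase _ _ (Finset.mem_univ i), Function.update_self]
  gcongr
  calc ∏ t ∈ Finset.univ.erase i, ‖Function.update w i x t‖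
      ≤ ∏ _t ∈ Finset.univ.erase i, α := by
        refine Finset.prod_le_prod (fun _ _ => norm_nonneg _) fun t ht => ?_
        rw [Function.update_of_ne (Finset.ne_of_mem_erase ht)]
        exact hw t
    _ = α ^ (r - 1) := by simp

variable {E : Type*} [NormedAddCommGroup E] [InnerProductSpace ℝ E]

/-- Cramer's rule in a lattice, with the coefficients bounded by Hadamard's inequality. -/
theorem exists_cramer {k r : ℕ} (a : Fin k → E) (hrank : finrank ℤ (latticeOf a) = r)
    (s : Fin r → Fin k) (hs : LinearIndependent ℝ (fun i => a (s i)))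
    {α : ℝ} (hα : ∀ j, ‖a j‖ ≤ α) :
    ∃ δ : ℤ, δ ≠ 0 ∧ |(δ : ℝ)| * latticeDet (latticeOf a) ≤ α ^ r ∧
      ∀ v ∈ latticeOf a, ∃ y : Fin r → ℤ, ∑ i, y i • a (s i) = δ • v ∧
        ∀ i, |(y i : ℝ)| * latticeDet (latticeOf a) ≤ ‖v‖ * α ^ (r - 1) := by
  obtain ⟨B, -, hspan, hdet, -⟩ := exists_basis_latticeDet a hrank s hs
  have hcoord : ∀ v ∈ latticeOf a, ∃ x : Fin r → ℤ, v = ∑ j, x j • B j := by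
    intro v hv
    rw [← hspan] at hv
    obtain ⟨x, hx⟩ := (Submodule.mem_span_range_iff_exists_fun ℤ).1 hv
    exact ⟨x, hx.symm⟩
  -- `P` holds the coordinates of the chosen vectors in a basis of the lattice; its determinant is
  -- `δ`.
  choose P hP using fun i => hcoord (a (s i)) (Submodule.subset_span ⟨s i, rfl⟩)
  have hcomb : ∀ y : Fin r → ℤ, ∑ i, y i • a (s i) =
      ∑ j, ((Matrix.of P).transpose.mulVec y) j • B j := by
    intro y
    simp_rw [hP, Finset.smul_sum, Matrix.mulVec, dotProduct, Finset.sum_smul]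
    rw [Finset.sum_comm]
    refine Finset.sum_congr rfl fun j _ => Finset.sum_congr rfl fun i _ => ?_
    rw [smul_smul, Matrix.transpose_apply, Matrix.of_apply, mul_comm]
  refine ⟨(Matrix.of P).det, ?_, ?_, ?_⟩
  · intro h0
    rw [← Matrix.det_transpose] at h0
    obtain ⟨u, hu, hu0⟩ := Matrix.exists_mulVec_eq_zero_iff.2 h0
    have h := hcomb u
    rw [hu0] at h
    simp only [Pi.zero_apply, zero_smul, Finset.sum_const_zero] at h
    refine hu (funext fun i => ?_)
    exact Fintype.linearIndependent_iff.1 (hs.restrict_scalars' ℤ) u h i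
  · rw [hdet]
    refine (abs_det_mul_sqrt_det_gram_le B _ (Matrix.of P) hP).trans ?_
    refine (Finset.prod_le_prod (fun _ _ => norm_nonneg _) fun i _ => hα (s i)).trans ?_
    simp
  · intro v hv
    obtain ⟨x, hx⟩ := hcoord v hv
    refine ⟨(Matrix.of P).transpose.cramer x, ?_, fun i => ?_⟩
    · rw [hcomb, Matrix.mulVec_cramer, Matrix.det_transpose, hx, Finset.smul_sum]
      simp [smul_smul]
    -- The `i`-th Cramer numerator is the coordinate determinant of the chosen family with `a (s i)`
    -- replaced by `v`.
    · rw [Matrix.cramer_transpose_apply, hdet]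
      refine (abs_det_mul_sqrt_det_gram_le B (Function.update (fun i => a (s i)) i v) _
        fun t => ?_).trans (prod_norm_update_le _ (fun i => hα (s i)) i v)
      rcases eq_or_ne t i with rfl | ht
      · simpa using hx
      · simpa [Function.update_of_ne ht, Matrix.updateRow_ne ht] using hP t

end Cramer

/-! ### Comparing augmented vectors with combinations of the `a_l`. -/

section Augmented

variable {k m : ℕ}

/-- The real linear map `(x, y) ↦ ∑ l, x_l a_l`. -/
noncomputable def combMap (a : Fin k → EuclideanSpace ℝ (Fin m)) :
    EuclideanSpace ℝ (Fin k ⊕ Fin m) →ₗ[ℝ] EuclideanSpace ℝ (Fin m) where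
  toFun z := ∑ l, z (Sum.inl l) • a l
  map_add' x y := by simp [add_smul, Finset.sum_add_distrib]
  map_smul' c x := by simp [mul_smul, Finset.smul_sum]

/-- The lattice vector `(x, ∑ l, x_l ahat_l)`. -/
noncomputable def augVec (ahat : Fin k → Fin m → ℤ) (x : Fin k → ℤ) :
    EuclideanSpace ℝ (Fin k ⊕ Fin m) :=
  ∑ l, x l • intVec (augmented ahat l)

/-- The integer vector `∑ l, x_l ahat_l`. -/
def hatComb (ahat : Fin k → Fin m → ℤ) (x : Fin k → ℤ) : Fin m → ℤ :=
  fun i => ∑ l, x l * ahat l i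

theorem augVec_eq (ahat : Fin k → Fin m → ℤ) (x : Fin k → ℤ) :
    augVec ahat x = intVec (Sum.elim x (hatComb ahat x)) := by
  ext t
  rcases t with t | t
  · simp [augVec, intVec, augmented, Pi.single_apply]
  · simp [augVec, intVec, augmented, hatComb]

theorem augVec_inl (ahat : Fin k → Fin m → ℤ) (x : Fin k → ℤ) (l : Fin k) :
    augVec ahat x (Sum.inl l) = x l := by
  rw [augVec_eq]
  rfl

theorem combMap_augVec (a : Fin k → EuclideanSpace ℝ (Fin m)) (ahat : Fin k → Fin m → ℤ)
    (x : Fin k → ℤ) : combMap a (augVec ahat x) = intComb x a := by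
  simp [combMap, augVec_inl, intComb, Int.cast_smul_eq_zsmul]

theorem augVec_mem (ahat : Fin k → Fin m → ℤ) (x : Fin k → ℤ) :
    augVec ahat x ∈ latticeOf fun j => intVec (augmented ahat j) :=
  Submodule.sum_mem _ fun l _ => Submodule.smul_mem _ _ (Submodule.subset_span ⟨l, rfl⟩)

theorem intVec_eq_augVec {ahat : Fin k → Fin m → ℤ} {b : Fin k → Fin k ⊕ Fin m → ℤ} {j : Fin k}
    (hb : intVec (b j) ∈ latticeOf fun j => intVec (augmented ahat j)) :
    intVec (b j) = augVec ahat (coeffPart b j) := by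
  obtain ⟨x, hx⟩ := (Submodule.mem_span_range_iff_exists_fun ℤ).1 hb
  change augVec ahat x = _ at hx
  have : x = coeffPart b j := by
    funext l
    have h := congrArg (fun z => z (Sum.inl l)) hx
    simp only [augVec_inl] at h
    change (x l : ℝ) = (coeffPart b j l : ℝ) at h
    exact_mod_cast h
  rw [← this, hx]

theorem norm_intVec_sumElim_sq (x : Fin k → ℤ) (y : Fin m → ℤ) :
    ‖intVec (Sum.elim x y)‖ ^ 2 = ‖intVec x‖ ^ 2 + ‖intVec y‖ ^ 2 := by
  simp [EuclideanSpace.norm_sq_eq, intVec]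

theorem norm_intVec_le_augVec (ahat : Fin k → Fin m → ℤ) (x : Fin k → ℤ) :
    ‖intVec x‖ ≤ ‖augVec ahat x‖ := by
  refine le_of_sq_le_sq ?_ (norm_nonneg _)
  rw [augVec_eq, norm_intVec_sumElim_sq]
  exact le_add_of_nonneg_right (sq_nonneg _)

theorem norm_hatComb_le_augVec (ahat : Fin k → Fin m → ℤ) (x : Fin k → ℤ) :
    ‖intVec (hatComb ahat x)‖ ≤ ‖augVec ahat x‖ := by
  refine le_of_sq_le_sq ?_ (norm_nonneg _)
  rw [augVec_eq, norm_intVec_sumElim_sq]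
  exact le_add_of_nonneg_left (sq_nonneg _)

theorem norm_augVec_le_add (ahat : Fin k → Fin m → ℤ) (x : Fin k → ℤ) :
    ‖augVec ahat x‖ ≤ ‖intVec x‖ + ‖intVec (hatComb ahat x)‖ := by
  refine le_of_sq_le_sq ?_ (by positivity)
  rw [augVec_eq, norm_intVec_sumElim_sq]
  nlinarith [mul_nonneg (norm_nonneg (intVec x)) (norm_nonneg (intVec (hatComb ahat x)))]

theorem norm_le_sqrt_card_mul {n : ℕ} (z : EuclideanSpace ℝ (Fin n)) {C : ℝ} (hC : 0 ≤ C)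
    (hz : ∀ i, |z i| ≤ C) : ‖z‖ ≤ √(n : ℝ) * C := by
  refine le_of_sq_le_sq ?_ (by positivity)
  rw [EuclideanSpace.norm_sq_eq, mul_pow, Real.sq_sqrt (by positivity)]
  calc ∑ i, ‖z i‖ ^ 2 ≤ ∑ _i : Fin n, C ^ 2 := by
        refine Finset.sum_le_sum fun i _ => ?_
        exact pow_le_pow_left₀ (norm_nonneg _) (hz i) 2
    _ = n * C ^ 2 := by simp

theorem sum_abs_le_sqrt_mul_norm (x : Fin k → ℤ) :
    ∑ l, |(x l : ℝ)| ≤ √(k : ℝ) * ‖intVec x‖ := by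
  refine le_of_sq_le_sq ?_ (by positivity)
  rw [mul_pow, Real.sq_sqrt (by positivity), EuclideanSpace.norm_sq_eq]
  simpa [intVec] using sq_sum_le_card_mul_sum_sq (s := Finset.univ) (f := fun l => |(x l : ℝ)|)

variable {q₀ q : ℕ} {a : Fin k → EuclideanSpace ℝ (Fin m)} {ahat : Fin k → Fin m → ℤ}

/-- Each coordinate of `ahat l` differs from that of `2 ^ q₀ • a l` by at most `2 ^ (q₀-q)`; the
factor `√m` passes from coordinates to the Euclidean norm. -/
theorem norm_hatComb_sub_le (hahat : ∀ j, IsApprox q₀ q (ahat j) (a j)) (x : Fin k → ℤ) :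
    ‖intVec (hatComb ahat x) - (2 : ℝ) ^ q₀ • intComb x a‖ ≤
      √(m : ℝ) * ((2 : ℝ) ^ q₀ / 2 ^ q * ∑ l, |(x l : ℝ)|) := by
  refine norm_le_sqrt_card_mul _ (by positivity) fun i => ?_
  have e : (intVec (hatComb ahat x) - (2 : ℝ) ^ q₀ • intComb x a) i =
      ∑ l, (x l : ℝ) * (2 ^ q₀ * ((ahat l i : ℝ) / 2 ^ q₀ - a l i)) := by
    simp only [intVec, hatComb, intComb, PiLp.sub_apply, PiLp.smul_apply, Int.cast_sum,
      Int.cast_mul, WithLp.ofLp_sum, Finset.sum_apply, WithLp.ofLp_smul,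
      Pi.mul_apply, Pi.intCast_apply, smul_eq_mul, zsmul_eq_mul, Finset.mul_sum, ← Finset.sum_sub_distrib]
    refine Finset.sum_congr rfl fun l _ => ?_
    field_simp
  rw [e, Finset.mul_sum]
  refine (Finset.abs_sum_le_sum_abs _ _).trans (Finset.sum_le_sum fun l _ => ?_)
  rw [abs_mul, abs_mul, abs_of_pos (by positivity : (0 : ℝ) < 2 ^ q₀)]
  calc |(x l : ℝ)| * (2 ^ q₀ * |(ahat l i : ℝ) / 2 ^ q₀ - a l i|)
      ≤ |(x l : ℝ)| * (2 ^ q₀ * (1 / 2 ^ q)) := by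
        gcongr
        exact hahat l i
    _ = _ := by ring

theorem norm_augVec_le (hahat : ∀ j, IsApprox q₀ q (ahat j) (a j)) (x : Fin k → ℤ) {C : ℝ}
    (hC : 0 ≤ C) (hx : ∀ l, |(x l : ℝ)| ≤ C) :
    ‖augVec ahat x‖ ≤ ((k : ℝ) * √(m : ℝ) * (2 : ℝ) ^ ((q₀ : ℝ) - (q : ℝ)) + √(k : ℝ)) * C +
      2 ^ q₀ * ‖intComb x a‖ := by
  have h1 := norm_augVec_le_add ahat x
  have h2 : ‖intVec x‖ ≤ √(k : ℝ) * C := norm_le_sqrt_card_mul _ hC hx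
  have h3 := norm_hatComb_sub_le hahat x
  have h4 := norm_le_norm_sub_add (intVec (hatComb ahat x)) ((2 : ℝ) ^ q₀ • intComb x a)
  have h5 : ∑ l, |(x l : ℝ)| ≤ k * C := by
    simpa using Finset.sum_le_sum fun (l : Fin k) (_ : l ∈ Finset.univ) => hx l
  have h6 : √(m : ℝ) * ((2 : ℝ) ^ q₀ / 2 ^ q * ∑ l, |(x l : ℝ)|) ≤
      √(m : ℝ) * ((2 : ℝ) ^ q₀ / 2 ^ q * (k * C)) := by gcongr
  rw [norm_smul, Real.norm_of_nonneg (by positivity)] at h4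
  rw [Real.rpow_sub (by norm_num), Real.rpow_natCast, Real.rpow_natCast]
  linarith

/-- A short augmented vector forces a short combination: the rounding error costs `√(mk)`, and the
exact part costs 1 because `2 ^ (q₀-q) ≥ 1`. -/
theorem two_pow_mul_norm_intComb_le (hqq₀ : q ≤ q₀)
    (hahat : ∀ j, IsApprox q₀ q (ahat j) (a j)) (x : Fin k → ℤ) :
    2 ^ q * ‖intComb x a‖ ≤ (√((m : ℝ) * (k : ℝ)) + 1) * ‖augVec ahat x‖ := by
  have h1 := norm_hatComb_sub_le hahat x
  have h2 := norm_le_norm_add_norm_sub' ((2 : ℝ) ^ q₀ • intComb x a) (intVec (hatComb ahat x))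
  rw [norm_smul, Real.norm_of_nonneg (by positivity), norm_sub_rev] at h2
  have h3 : ∑ l, |(x l : ℝ)| ≤ √(k : ℝ) * ‖augVec ahat x‖ :=
    (sum_abs_le_sqrt_mul_norm x).trans (by gcongr; exact norm_intVec_le_augVec ahat x)
  have h4 : (1 : ℝ) ≤ 2 ^ q₀ / 2 ^ q := by
    rw [one_le_div (by positivity)]
    exact pow_le_pow_right₀ (by norm_num) hqq₀
  have h5 : (2 : ℝ) ^ q₀ * ‖intComb x a‖ ≤
      2 ^ q₀ / 2 ^ q * ((√((m : ℝ) * (k : ℝ)) + 1) * ‖augVec ahat x‖) := by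
    calc (2 : ℝ) ^ q₀ * ‖intComb x a‖
        ≤ 1 * ‖augVec ahat x‖ +
            √(m : ℝ) * ((2 : ℝ) ^ q₀ / 2 ^ q * (√(k : ℝ) * ‖augVec ahat x‖)) := by
          rw [one_mul]
          refine h2.trans (add_le_add (norm_hatComb_le_augVec ahat x) (h1.trans ?_))
          gcongr
      _ ≤ 2 ^ q₀ / 2 ^ q * ‖augVec ahat x‖ +
            √(m : ℝ) * ((2 : ℝ) ^ q₀ / 2 ^ q * (√(k : ℝ) * ‖augVec ahat x‖)) := by gcongr
      _ = _ := by
          rw [Real.sqrt_mul (by positivity)]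
          ring
  have h6 : (2 : ℝ) ^ q₀ * ‖intComb x a‖ = 2 ^ q₀ / 2 ^ q * (2 ^ q * ‖intComb x a‖) := by
    field_simp
  rw [h6] at h5
  exact le_of_mul_le_mul_left h5 (by positivity)

end Augmented

/-! ### Extending coefficients by zero, and independence through a linear map. -/

section Combination

theorem intComb_extend {E : Type*} [AddCommGroup E] {k r : ℕ} {s : Fin r → Fin k}
    (hs : Function.Injective s) (y : Fin r → ℤ) (a : Fin k → E) :
    intComb (Function.extend s y 0) a = ∑ i, y i • a (s i) := by
  refine (Fintype.sum_of_injective s hs _ _ (fun t ht => ?_) fun i => ?_).symm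
  · rw [Function.extend_apply' _ _ _ ht, Pi.zero_apply, zero_smul]
  · rw [hs.extend_apply]

theorem linearIndependent_sumElim_of_map {V W ι κ : Type*} [AddCommGroup V] [Module ℝ V]
    [AddCommGroup W] [Module ℝ W] [Fintype ι] [Fintype κ] (f : V →ₗ[ℝ] W) {u : ι → V}
    {w : κ → V} (hu : LinearIndependent ℝ u) (hfu : ∀ i, f (u i) = 0)
    (hw : LinearIndependent ℝ fun j => f (w j)) : LinearIndependent ℝ (Sum.elim u w) := by
  rw [Fintype.linearIndependent_iff] at hu hw ⊢
  intro g hg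
  rw [Fintype.sum_sum_type] at hg
  simp only [Sum.elim_inl, Sum.elim_inr] at hg
  have hr : ∀ j, g (Sum.inr j) = 0 := by
    refine hw (fun j => g (Sum.inr j)) ?_
    simpa [map_add, map_sum, hfu] using congrArg f hg
  have hl : ∀ i, g (Sum.inl i) = 0 := by
    refine hu (fun i => g (Sum.inl i)) ?_
    simpa [hr] using hg
  rintro (i | j)
  · exact hl i
  · exact hr j

end Combination

/-! ### Short independent families in the augmented lattice. -/

section Families

variable {k m r q₀ q : ℕ} {a : Fin k → EuclideanSpace ℝ (Fin m)} {ahat : Fin k → Fin m → ℤ}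
  {s : Fin r → Fin k} {α : ℝ}

/-- There are `k - r` independent short vectors of the augmented lattice coming from relations. -/
theorem exists_short_relations (hrank : finrank ℤ (latticeOf a) = r)
    (hahat : ∀ j, IsApprox q₀ q (ahat j) (a j))
    (hs : LinearIndependent ℝ (fun i => a (s i))) (hα : ∀ j, ‖a j‖ ≤ α) :
    ∃ x : {l // l ∉ Set.range s} → Fin k → ℤ,
      LinearIndependent ℝ (fun l => augVec ahat (x l)) ∧ (∀ l, intComb (x l) a = 0) ∧
      ∀ l, ‖augVec ahat (x l)‖ ≤
        ((k : ℝ) * √(m : ℝ) * (2 : ℝ) ^ ((q₀ : ℝ) - (q : ℝ)) + √(k : ℝ)) *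
          (α ^ r / latticeDet (latticeOf a)) := by
  have hinj : Function.Injective s := fun i j h => hs.injective (congrArg a h)
  obtain ⟨-, -, -, -, hD⟩ := exists_basis_latticeDet a hrank s hs
  obtain ⟨δ, hδ0, hδ, hc⟩ := exists_cramer a hrank s hs hα
  choose y hy hyle using fun l : {l // l ∉ Set.range s} =>
    hc (a l) (Submodule.subset_span ⟨l.1, rfl⟩)
  -- The Cramer relation `δ • a l - ∑ i, y i • a (s i) = 0`. On the indices outside the range of `s`
  -- these vectors form `δ` times the identity, whence independence.
  let x : {l // l ∉ Set.range s} → Fin k → ℤ := fun l =>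
    Pi.single l.1 δ - Function.extend s (y l) 0
  have hxs : ∀ l i, x l (s i) = -y l i := by
    intro l i
    have : s i ≠ l := fun h => l.2 ⟨i, h⟩
    simp [x, hinj.extend_apply, this]
  have hxn : ∀ l (t : {l // l ∉ Set.range s}), x l t = if t = l then δ else 0 := by
    intro l t
    have : Function.extend s (y l) 0 t.1 = 0 := Function.extend_apply' _ _ _ t.2
    simp [x, this, Pi.single_apply, Subtype.ext_iff]
  have hrel : ∀ l, intComb (x l) a = 0 := by
    intro l
    have h1 : intComb (x l) a = intComb (Pi.single l.1 δ) a -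
        intComb (Function.extend s (y l) 0) a := by
      simp [intComb, x, sub_smul]
    have h2 : intComb (Pi.single l.1 δ) a = δ • a l := by
      simp [intComb, Pi.single_apply, ite_smul]
    rw [h1, h2, intComb_extend hinj, hy, sub_self]
  refine ⟨x, ?_, hrel, fun l => ?_⟩
  · rw [Fintype.linearIndependent_iff]
    intro g hg t
    have h := congrArg (fun z => z (Sum.inl t.1)) hg
    simp only [WithLp.ofLp_sum, Finset.sum_apply, WithLp.ofLp_smul, Pi.smul_apply, augVec_inl,
      hxn, smul_eq_mul] at h
    simpa [hδ0] using h
  · have hα0 : 0 ≤ α := (norm_nonneg _).trans (hα l)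
    have hbound : ∀ t, |(x l t : ℝ)| ≤ α ^ r / latticeDet (latticeOf a) := by
      intro t
      rw [le_div_iff₀ hD]
      by_cases ht : t ∈ Set.range s
      · obtain ⟨i, rfl⟩ := ht
        rw [hxs, Int.cast_neg, abs_neg]
        refine (hyle l i).trans ?_
        have hr : r - 1 + 1 = r := Nat.sub_add_cancel (Nat.one_le_of_lt i.isLt)
        calc ‖a l‖ * α ^ (r - 1) ≤ α * α ^ (r - 1) := by
              gcongr
              exact hα l
          _ = α ^ r := by rw [← pow_succ', hr]
      · rw [hxn l ⟨t, ht⟩]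
        split_ifs
        · exact hδ
        · simp only [Int.cast_zero, abs_zero, zero_mul]
          positivity
    have h := norm_augVec_le hahat (x l) (by positivity) hbound
    rwa [hrel, norm_zero, mul_zero, add_zero] at h

/-- Membership in `L_r`, rather than in `L`, supplies integer coefficients `c` on the chosen
vectors. Cramer's numerators are `δ * c i` with `|δ| ≥ 1`, so their bounds also bound `c`. -/
theorem exists_short_lift (hrank : finrank ℤ (latticeOf a) = r)
    (hahat : ∀ j, IsApprox q₀ q (ahat j) (a j))
    (hs : LinearIndependent ℝ (fun i => a (s i))) (hα : ∀ j, ‖a j‖ ≤ α) (hα0 : 0 ≤ α)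
    {v : EuclideanSpace ℝ (Fin m)} (hv : v ∈ latticeOf fun i => a (s i)) :
    ∃ c : Fin k → ℤ, intComb c a = v ∧ ‖augVec ahat c‖ ≤
      ((k : ℝ) * √(m : ℝ) * (2 : ℝ) ^ ((q₀ : ℝ) - (q : ℝ)) + √(k : ℝ)) *
          (‖v‖ * α ^ (r - 1) / latticeDet (latticeOf a)) + 2 ^ q₀ * ‖v‖ := by
  have hinj : Function.Injective s := fun i j h => hs.injective (congrArg a h)
  obtain ⟨-, -, -, -, hD⟩ := exists_basis_latticeDet a hrank s hs
  obtain ⟨δ, hδ0, -, hcr⟩ := exists_cramer a hrank s hs hα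
  obtain ⟨c, hc⟩ := (Submodule.mem_span_range_iff_exists_fun ℤ).1 hv
  have hva : v ∈ latticeOf a := by
    refine Submodule.span_mono ?_ hv
    rintro _ ⟨i, rfl⟩
    exact ⟨s i, rfl⟩
  obtain ⟨y, hy, hyle⟩ := hcr v hva
  have hyc : ∀ i, y i = δ * c i := by
    intro i
    have h0 : ∑ i, (y i - δ * c i) • a (s i) = 0 := by
      simp only [sub_smul, Finset.sum_sub_distrib, hy, mul_smul, ← Finset.smul_sum, hc, sub_self]
    exact sub_eq_zero.1 (Fintype.linearIndependent_iff.1 (hs.restrict_scalars' ℤ) _ h0 i)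
  have hcv : intComb (Function.extend s c 0) a = v := by rw [intComb_extend hinj, hc]
  refine ⟨Function.extend s c 0, hcv, ?_⟩
  have h := norm_augVec_le hahat (Function.extend s c 0)
    (C := ‖v‖ * α ^ (r - 1) / latticeDet (latticeOf a)) (by positivity) fun t => ?_
  · rwa [hcv] at h
  · rw [le_div_iff₀ hD]
    by_cases ht : t ∈ Set.range s
    · obtain ⟨i, rfl⟩ := ht
      rw [hinj.extend_apply]
      refine le_trans ?_ (hyle i)
      refine mul_le_mul_of_nonneg_right ?_ hD.le
      rw [hyc, Int.cast_mul, abs_mul]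
      have h1 : (1 : ℝ) ≤ |(δ : ℝ)| := by exact_mod_cast Int.one_le_abs hδ0
      exact le_mul_of_one_le_left (abs_nonneg _) h1
    · rw [Function.extend_apply' _ _ _ ht]
      simp only [Pi.zero_apply, Int.cast_zero, abs_zero, zero_mul]
      positivity

/-- The family `w` makes the set of radii nonempty; otherwise its `sInf` would be the default value
0. -/
theorem le_mul_successiveMin {E : Type*} [NormedAddCommGroup E] [InnerProductSpace ℝ E]
    {L : Submodule ℤ E} {j : ℕ} {w : Fin j → E} (hw : LinearIndependent ℝ w)
    (hwL : ∀ i, w i ∈ L) {C X : ℝ} (hC : 0 < C)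
    (h : ∀ (ρ : ℝ) (v : Fin j → E), LinearIndependent ℝ v → (∀ i, v i ∈ L ∧ ‖v i‖ ≤ ρ) →
      X ≤ C * ρ) : X ≤ C * successiveMin L j := by
  rw [← div_le_iff₀' hC]
  refine le_csInf ⟨∑ i, ‖w i‖, Finset.sum_nonneg fun _ _ => norm_nonneg _, w, hw, fun i =>
    ⟨hwL i, Finset.single_le_sum (f := fun i => ‖w i‖) (fun _ _ => norm_nonneg _)
      (Finset.mem_univ i)⟩⟩ ?_
  rintro ρ ⟨-, v, hv, hvL⟩
  rw [div_le_iff₀' hC]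
  exact h ρ v hv hvL

end Families

end ApproxLattice

/-! ### The main theorem. -/

/-- `a_1, …, a_k` generate a lattice `L` of rank `r` in `ℝ^m`, `ahat_j` are approximations of
precision `q` and denominator `2 ^ q₀`, and `btilde_j = (m_j, bhat_j)` is any LLL-reduced basis
of the lattice generated by the vectors `(e_j, ahat_j)`. The family `a ∘ s` is any choice of `r` linearly
independent vectors among the `a_j` and generates `L_r`; the hypothesis `hμ` says `μ ≤ λ_1(L)`. -/
theorem mainTheorem2 {k m r : ℕ} (hrk : r ≤ k) (q₀ q : ℕ) (hq : 0 < q) (hqq₀ : q ≤ q₀)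
    (a : Fin k → EuclideanSpace ℝ (Fin m))
    (hdiscrete : DiscreteTopology (latticeOf a))
    (hrank : Module.finrank ℤ (latticeOf a) = r)
    (ahat : Fin k → Fin m → ℤ) (hahat : ∀ j, IsApprox q₀ q (ahat j) (a j))
    (btilde : Fin k → Fin k ⊕ Fin m → ℤ)
    (hbtilde : IsLLLReducedBasis (latticeOf fun j => intVec (augmented ahat j))
      (fun j => intVec (btilde j)))
    (s : Fin r → Fin k) (hs : LinearIndependent ℝ (fun i => a (s i)))
    (μ : ℝ) (hμ_pos : 0 < μ) (hμ : ∀ v ∈ latticeOf a, v ≠ 0 → μ ≤ ‖v‖)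
    (α : ℝ) (hα : ∀ j, ‖a j‖ ≤ α)
    (lam : ℝ)
    (hlam : lam = ((k : ℝ) * √(m : ℝ) * (2 : ℝ) ^ ((q₀ : ℝ) - (q : ℝ)) + √(k : ℝ)) *
      (α ^ r / latticeDet (latticeOf a)))
    (hprec : (2 : ℝ) ^ q >
      (√((m : ℝ) * (k : ℝ)) + 1) * lam * (2 : ℝ) ^ (((k : ℝ) - 1) / 2) / μ) :
    -- the first `k - r` coefficient vectors are linearly independent relations
    LinearIndependent ℤ (fun j : Fin (k - r) => coeffPart btilde (firstIdx j)) ∧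
    (∀ j : Fin (k - r), intComb (coeffPart btilde (firstIdx j)) a = 0) ∧
    -- the last `r` ones give a basis of `L`
    LinearIndependent ℝ (fun j : Fin r => intComb (coeffPart btilde (lastIdx hrk j)) a) ∧
    latticeOf (fun j : Fin r => intComb (coeffPart btilde (lastIdx hrk j)) a) = latticeOf a ∧
    (∀ j : Fin r, ‖intComb (coeffPart btilde (lastIdx hrk j)) a‖ ≤
      (√((k : ℝ) * (m : ℝ)) + 1) *
        (2 : ℝ) ^ (((k : ℝ) - 1) / 2 + 1 + (q₀ : ℝ) - (q : ℝ)) *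
        successiveMin (latticeOf fun i => a (s i)) ((j : ℕ) + 1)) ∧
    -- norm bounds for the coefficient vectors
    (∀ j : Fin (k - r), ‖intVec (coeffPart btilde (firstIdx j))‖ ≤
      (2 : ℝ) ^ (((k : ℝ) - 1) / 2) * lam) ∧
    (∀ j : Fin r, ‖intVec (coeffPart btilde (lastIdx hrk j))‖ ≤
      (2 : ℝ) ^ (((k : ℝ) - 1) / 2 + (q₀ : ℝ) + 1) *
        successiveMin (latticeOf fun i => a (s i)) ((j : ℕ) + 1)) := by
  classical
  obtain ⟨hred, hspan⟩ := hbtilde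
  have hinj : Function.Injective s := fun i j h => hs.injective (congrArg a h)
  have hb : ∀ j, intVec (btilde j) = augVec ahat (coeffPart btilde j) := by
    intro j
    refine intVec_eq_augVec ?_
    rw [← hspan]
    exact Submodule.subset_span ⟨j, rfl⟩
  have hmem : ∀ x, augVec ahat x ∈ latticeOf fun j => intVec (btilde j) := by
    intro x
    rw [hspan]
    exact augVec_mem ahat x
  obtain ⟨x, hxind, hxrel, hxle⟩ := exists_short_relations (ahat := ahat) hrank hahat hs hα
  rw [← hlam] at hxle
  have hcard : Fintype.card {l // l ∉ Set.range s} = k - r := by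
    rw [Fintype.card_subtype_compl, Fintype.card_fin]
    congr 1
    exact (Set.card_range_of_injective hinj).trans (Fintype.card_fin r)
  set K := (2 : ℝ) ^ (((k : ℝ) - 1) / 2) with hK
  have hK0 : 0 < K := by positivity
  -- the short vectors of the reduced basis
  have hfirst : ∀ j : Fin (k - r), ‖augVec ahat (coeffPart btilde (firstIdx j))‖ ≤ K * lam := by
    intro j
    rw [← hb]
    exact hred.norm_le_of_linearIndependent hxind (fun t => hmem _) hxle
      (j := firstIdx j) (by rw [hcard]; exact j.isLt)
  have hprec' : (√((m : ℝ) * (k : ℝ)) + 1) * lam * K < 2 ^ q * μ := by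
    rwa [gt_iff_lt, div_lt_iff₀ hμ_pos] at hprec
  have hcombmem : ∀ c : Fin k → ℤ, intComb c a ∈ latticeOf a := fun c =>
    Submodule.sum_mem _ fun l _ => Submodule.smul_mem _ _ (Submodule.subset_span ⟨l, rfl⟩)
  have hrel : ∀ j : Fin (k - r), intComb (coeffPart btilde (firstIdx j)) a = 0 := by
    intro j
    by_contra hne
    have h1 := hμ _ (hcombmem _) hne
    have h2 := two_pow_mul_norm_intComb_le hqq₀ hahat (coeffPart btilde (firstIdx j))
    have h3 : (√((m : ℝ) * (k : ℝ)) + 1) * ‖augVec ahat (coeffPart btilde (firstIdx j))‖ ≤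
        (√((m : ℝ) * (k : ℝ)) + 1) * (K * lam) := by
      gcongr
      exact hfirst j
    have h4 : (2 : ℝ) ^ q * μ ≤ 2 ^ q * ‖intComb (coeffPart btilde (firstIdx j)) a‖ := by gcongr
    linarith
  -- the lattice generated by the remaining combinations
  have hgen : latticeOf (fun j : Fin r => intComb (coeffPart btilde (lastIdx hrk j)) a) =
      latticeOf a := by
    refine le_antisymm (Submodule.span_le.2 ?_) (Submodule.span_le.2 ?_)
    · rintro _ ⟨j, rfl⟩
      exact hcombmem _
    · rintro _ ⟨l, rfl⟩
      -- Expand the `l`-th augmented generator in the reduced basis and apply `combMap`: the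
      -- relations vanish, leaving `a l` as a combination of the last `r` vectors.
      obtain ⟨n, hn⟩ := (Submodule.mem_span_range_iff_exists_fun ℤ).1 (hmem (Pi.single l 1))
      have h := congrArg (combMap a) hn
      simp only [hb, map_sum, map_zsmul, combMap_augVec] at h
      have hl : intComb (Pi.single l 1) a = a l := by
        simp [intComb, Pi.single_apply, ite_smul]
      rw [hl] at h
      rw [← h]
      refine Submodule.sum_mem _ fun j _ => Submodule.smul_mem _ _ ?_
      by_cases hj : (j : ℕ) < k - r
      · have : intComb (coeffPart btilde j) a = 0 := hrel ⟨j, hj⟩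
        rw [this]
        exact Submodule.zero_mem _
      · refine Submodule.subset_span ⟨⟨j - (k - r), by omega⟩, ?_⟩
        have : lastIdx hrk ⟨j - (k - r), by omega⟩ = j := Fin.ext (by simp [lastIdx]; omega)
        simp only [this]
  have hlast : ∀ (j : Fin r) (ρ : ℝ) (v : Fin ((j : ℕ) + 1) → EuclideanSpace ℝ (Fin m)),
      LinearIndependent ℝ v → (∀ i, v i ∈ latticeOf (fun i => a (s i)) ∧ ‖v i‖ ≤ ρ) →
      ‖augVec ahat (coeffPart btilde (lastIdx hrk j))‖ ≤ K * (2 ^ (q₀ + 1) * ρ) := by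
    intro j ρ v hv hvL
    obtain ⟨-, -, -, -, hD⟩ := exists_basis_latticeDet a hrank s hs
    have hsub : ∀ z ∈ latticeOf (fun i => a (s i)), z ∈ latticeOf a := by
      intro z hz
      refine Submodule.span_mono ?_ hz
      rintro _ ⟨i, rfl⟩
      exact ⟨s i, rfl⟩
    have hμρ : μ ≤ ρ := (hμ _ (hsub _ (hvL 0).1) (hv.ne_zero 0)).trans (hvL 0).2
    have hμα : μ ≤ α :=
      (hμ _ (Submodule.subset_span ⟨s j, rfl⟩) (hs.ne_zero j)).trans (hα (s j))
    have hα0 : 0 < α := hμ_pos.trans_le hμα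
    have hρ0 : 0 < ρ := hμ_pos.trans_le hμρ
    have hk1 : (1 : ℝ) ≤ k := by
      have := j.isLt
      exact_mod_cast (by omega : 1 ≤ k)
    have hK1 : 1 ≤ K := Real.one_le_rpow (by norm_num) (by linarith)
    have hlam0 : 0 ≤ lam := by
      rw [hlam]
      positivity
    -- A weakening of the precision hypothesis, whose other factors are at least 1; it absorbs the
    -- rounding terms into `2 ^ q₀ * ρ`.
    have hlamμ : lam ≤ 2 ^ q * μ := by
      refine le_trans ?_ hprec'.le
      calc lam = 1 * lam * 1 := by ring
        _ ≤ (√((m : ℝ) * (k : ℝ)) + 1) * lam * K := by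
            gcongr
            exact le_add_of_nonneg_left (Real.sqrt_nonneg _)
    have hpow : (2 : ℝ) ^ q ≤ 2 ^ q₀ := pow_le_pow_right₀ (by norm_num) hqq₀
    choose c hc hcle using fun i =>
      exists_short_lift hrank hahat hs hα hα0.le (hvL i).1
    have hind : LinearIndependent ℝ
        (Sum.elim (fun l => augVec ahat (x l)) fun i => augVec ahat (c i)) := by
      refine linearIndependent_sumElim_of_map (combMap a) hxind (fun l => ?_) ?_
      · rw [combMap_augVec, hxrel]
      · simpa only [combMap_augVec, hc] using hv
    rw [← hb]
    refine hred.norm_le_of_linearIndependent hind ?_ ?_ (j := lastIdx hrk j) ?_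
    · rintro (l | i)
      · exact hmem _
      · exact hmem _
    · rintro (l | i)
      · calc ‖augVec ahat (x l)‖ ≤ lam := hxle l
          _ ≤ 2 ^ q * μ := hlamμ
          _ ≤ 2 ^ q₀ * ρ := by gcongr
          _ ≤ 2 ^ (q₀ + 1) * ρ := by
              gcongr
              · norm_num
              · omega
      · refine (hcle i).trans ?_
        have hr : r - 1 + 1 = r := Nat.sub_add_cancel (Nat.one_le_of_lt j.isLt)
        -- Multiplied by `α`, the left side is `lam`, and `lam ≤ 2 ^ q * μ ≤ 2 ^ q₀ * α`. Here `r ≥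
        -- 1`, so `r - 1` is not truncated.
        have hW : ((k : ℝ) * √(m : ℝ) * (2 : ℝ) ^ ((q₀ : ℝ) - (q : ℝ)) + √(k : ℝ)) *
            (α ^ (r - 1) / latticeDet (latticeOf a)) ≤ 2 ^ q₀ := by
          refine le_of_mul_le_mul_right ?_ hα0
          calc _ = lam := by
                rw [hlam]
                conv_rhs => rw [← hr, pow_succ]
                ring
            _ ≤ 2 ^ q * μ := hlamμ
            _ ≤ 2 ^ q₀ * α := by gcongr
        calc _ = ((k : ℝ) * √(m : ℝ) * (2 : ℝ) ^ ((q₀ : ℝ) - (q : ℝ)) + √(k : ℝ)) *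
            (α ^ (r - 1) / latticeDet (latticeOf a)) * ‖v i‖ + 2 ^ q₀ * ‖v i‖ := by ring
          _ ≤ 2 ^ q₀ * ρ + 2 ^ q₀ * ρ := by
              have := (hvL i).2
              gcongr
          _ = 2 ^ (q₀ + 1) * ρ := by ring
    -- The combined family has `(k - r) + (j + 1)` members, one more than the zero-based index `k -
    -- r + j`.
    · rw [Fintype.card_sum, hcard, Fintype.card_fin]
      simp only [lastIdx]
      omega
  have hsucc : ∀ (j : Fin r) (X C : ℝ), 0 < C →
      (∀ ρ : ℝ, ‖augVec ahat (coeffPart btilde (lastIdx hrk j))‖ ≤ K * (2 ^ (q₀ + 1) * ρ) →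
        X ≤ C * ρ) →
      X ≤ C * successiveMin (latticeOf fun i => a (s i)) ((j : ℕ) + 1) := by
    intro j X C hC h
    refine le_mul_successiveMin
      (w := fun i => a (s (Fin.castLE (Nat.succ_le_of_lt j.isLt) i)))
      (hs.comp _ (Fin.castLE_injective _))
      (fun i => Submodule.subset_span (Set.mem_range_self (f := fun i => a (s i)) _)) hC
      fun ρ v hv hvL => h ρ (hlast j ρ v hv hvL)
  refine ⟨?_, hrel, ?_, hgen, ?_, ?_, ?_⟩
  · have h1 : LinearIndependent ℤ (fun j => augVec ahat (coeffPart btilde j)) := by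
      simpa only [hb] using hred.linearIndependent.restrict_scalars' ℤ
    have h2 : LinearIndependent ℤ (coeffPart btilde) := by
      rw [Fintype.linearIndependent_iff] at h1 ⊢
      intro g hg
      refine h1 g ?_
      have e : ∑ j, g j • augVec ahat (coeffPart btilde j) =
          augVec ahat (∑ j, g j • coeffPart btilde j) := by
        simp only [augVec, Finset.smul_sum, smul_smul, Finset.sum_apply, Pi.smul_apply,
          Finset.sum_smul, smul_eq_mul]
        exact Finset.sum_comm
      rw [e, hg]
      simp [augVec]
    exact h2.comp _ fun i j h => Fin.ext (by simpa [firstIdx] using h)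
  -- These `r` vectors span a real space containing the `r` independent vectors `a (s i)`.
  · rw [linearIndependent_iff_card_le_finrank_span, Set.finrank]
    have hle : Submodule.span ℝ (Set.range fun i => a (s i)) ≤ Submodule.span ℝ
        (Set.range fun j : Fin r => intComb (coeffPart btilde (lastIdx hrk j)) a) := by
      rw [Submodule.span_le]
      rintro _ ⟨i, rfl⟩
      have : a (s i) ∈ latticeOf
          (fun j : Fin r => intComb (coeffPart btilde (lastIdx hrk j)) a) := by
        rw [hgen]
        exact Submodule.subset_span ⟨s i, rfl⟩
      exact Submodule.span_le_restrictScalars ℤ ℝ _ this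
    have h := Submodule.finrank_mono hle
    rwa [finrank_span_eq_card hs] at h
  · intro j
    refine hsucc j _ _ (by positivity) fun ρ h => ?_
    have h2 := two_pow_mul_norm_intComb_le hqq₀ hahat (coeffPart btilde (lastIdx hrk j))
    have e : (2 : ℝ) ^ (((k : ℝ) - 1) / 2 + 1 + (q₀ : ℝ) - (q : ℝ)) =
        K * 2 ^ (q₀ + 1) / 2 ^ q := by
      rw [Real.rpow_sub (by norm_num), Real.rpow_add (by norm_num), Real.rpow_add (by norm_num),
        Real.rpow_natCast, Real.rpow_natCast, Real.rpow_one, pow_succ]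
      ring
    have h3 : 2 ^ q * ‖intComb (coeffPart btilde (lastIdx hrk j)) a‖ ≤
        (√((m : ℝ) * (k : ℝ)) + 1) * (K * (2 ^ (q₀ + 1) * ρ)) := h2.trans (by gcongr)
    rw [e, mul_comm (k : ℝ)]
    rw [← le_div_iff₀' (by positivity)] at h3
    refine h3.trans (le_of_eq ?_)
    ring
  · exact fun j => (norm_intVec_le_augVec ahat _).trans (hfirst j)
  · intro j
    refine hsucc j _ _ (by positivity) fun ρ h => ?_
    refine (norm_intVec_le_augVec ahat _).trans (h.trans (le_of_eq ?_))
    rw [Real.rpow_add (by norm_num), Real.rpow_add (by norm_num), Real.rpow_natCast,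
      Real.rpow_one, pow_succ]
    ring
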